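/- Let $\Omega\subset\mathbb R^2$ be a bounded domain (nonempty, open, connected) with smooth boundary, of area $|\Omega|$, and let $n=n(\Omega)$ be its number of holes, i.e. of bounded connected components of $\mathbb R^2\setminus\Omega$. Let $A$ be a closed real $1$-form on $\Omega$, smooth up to the boundary. For a complex function $u$ put $\nabla^A u=\nabla u-iuA^\sharp$, where $A^\sharp$ is the vector field dual to $A$, and let $$\lambda_1(\Omega,A)=\inf\Big\{\frac{\int_\Omega|\nabla^A u|^2}{\int_\Omega|u|^2}:\ u\in H^1(\Omega,\mathbb C)\setminus\{0\}\Big\}$$ be the lowest eigenvalue of the magnetic Laplacian with magnetic Neumann boundary conditions. An admissible cut of $\Omega$ is a family $\Gamma=(\Gamma_1,\dots,\Gamma_n)$ of $n=n(\Omega)$ nondegenerate closed segments such that $\Omega\setminus(\Gamma_1\cup\dots\cup\Gamma_n)$ is simply connected; $h_j$ denotes the length of $\Gamma_j$. If $\Gamma$ is an admissible cut of $\Omega$ with $h_j\le 1$ for every $j$ and $\sum_{j=1}^n h_j\le \frac{|\Omega|}{2\pi}$, then $$\lambda_1(\Omega,A)\le\frac{8\pi\, n(\Omega)}{|\Omega|}\sum_{j=1}^n\frac{1}{\left|\ln\frac{h_j}{2}\right|}.$$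 In particular, if $h(\Omega)$ denotes the minimum of the total length $\sum_j h_j$ over all admissible cuts, this inequality holds when $h(\Omega)\le\frac{|\Omega|}{2\pi}$ and $h_1,\dots,h_n\le 1$ are the lengths of the segments of an admissible cut of total length $h(\Omega)$. -/

import Mathlib

open MeasureTheory
open scoped ContDiff

noncomputable section

/-- The Euclidean plane. -/
abbrev Plane : Type := EuclideanSpace ℝ (Fin 2)

/-- The standard basis vectors of the plane. -/
def stdVec (j : Fin 2) : Plane := EuclideanSpace.single j 1

/-- `Ω` is a bounded domain (nonempty, open, connected) of the plane with smooth boundary: near each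
boundary point, `Ω` is the negativity set of a smooth function with nonvanishing differential. -/
structure IsSmoothBoundedDomain (Ω : Set Plane) : Prop where
  isOpen : IsOpen Ω
  isConnected : IsConnected Ω
  isBounded : Bornology.IsBounded Ω
  smooth_boundary : ∀ p ∈ frontier Ω, ∃ (U : Set Plane) (ρ : Plane → ℝ),
    IsOpen U ∧ p ∈ U ∧ ContDiffOn ℝ ∞ ρ U ∧ fderiv ℝ ρ p ≠ 0 ∧
      ∀ x ∈ U, x ∈ Ω ↔ ρ x < 0

/-- The holes of `Ω`: the bounded connected components of its complement. -/
def holes (Ω : Set Plane) : Set (Set Plane) :=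
  {C | Bornology.IsBounded C ∧ ∃ x ∈ Ωᶜ, C = connectedComponentIn Ωᶜ x}

/-- The number `n(Ω)` of holes (finite when `Ω` is a smooth bounded domain). -/
def numHoles (Ω : Set Plane) : ℕ := (holes Ω).ncard

/-- A real `1`-form `A` that is smooth on the closure of `Ω` and closed on `Ω`. -/
structure IsClosedPotential (Ω : Set Plane) (A : Plane → (Plane →L[ℝ] ℝ)) : Prop where
  smooth : ContDiffOn ℝ ∞ A (closure Ω)
  closed : ∀ x ∈ Ω, ∀ v w : Plane, fderiv ℝ A x v w = fderiv ℝ A x w v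

/-- `g` is the weak partial derivative of `u` in the `j`-th direction on `Ω`. -/
def IsWeakPartialDeriv (Ω : Set Plane) (j : Fin 2) (u g : Plane → ℂ) : Prop :=
  ∀ φ : Plane → ℝ, ContDiff ℝ ∞ φ → HasCompactSupport φ → tsupport φ ⊆ Ω →
    ∫ x in Ω, fderiv ℝ φ x (stdVec j) • u x = - ∫ x in Ω, φ x • g x

/-- `u` belongs to the Sobolev space `H¹(Ω)` of complex functions, with weak gradient
`g = (g 0, g 1)`. -/
structure IsH1WithGrad (Ω : Set Plane) (u : Plane → ℂ) (g : Fin 2 → Plane → ℂ) : Prop where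
  memLp : MemLp u 2 (volume.restrict Ω)
  memLp_grad : ∀ j, MemLp (g j) 2 (volume.restrict Ω)
  weak : ∀ j, IsWeakPartialDeriv Ω j u (g j)

/-- `|∇ᴬ u|²` at `x`, with `∇ᴬ u = ∇u - i u A♯` and `g = ∇u`. -/
def magneticGradSq (A : Plane → (Plane →L[ℝ] ℝ)) (u : Plane → ℂ) (g : Fin 2 → Plane → ℂ)
    (x : Plane) : ℝ :=
  ∑ j, ‖g j x - Complex.I * u x * (A x (stdVec j) : ℂ)‖ ^ 2

/-- The ground state energy `λ₁(Ω, A)` of the magnetic Neumann Laplacian: the infimum of the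
Rayleigh quotient over the nonzero elements of `H¹(Ω)`. -/
def lambdaOne (Ω : Set Plane) (A : Plane → (Plane →L[ℝ] ℝ)) : ℝ :=
  sInf {R : ℝ | ∃ (u : Plane → ℂ) (g : Fin 2 → Plane → ℂ), IsH1WithGrad Ω u g ∧
    ¬ (u =ᵐ[volume.restrict Ω] 0) ∧
    R = (∫ x in Ω, magneticGradSq A u g x) / ∫ x in Ω, ‖u x‖ ^ 2}

/-- A family of `n` nondegenerate closed segments, given by their pairs of endpoints, is an
admissible cut of `Ω` if deleting all of them from `Ω` leaves a simply connected set. -/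
structure IsAdmissibleCut (Ω : Set Plane) {n : ℕ} (Γ : Fin n → Plane × Plane) : Prop where
  nondegenerate : ∀ j, (Γ j).1 ≠ (Γ j).2
  simplyConnected : IsSimplyConnected (Ω \ ⋃ j, segment ℝ (Γ j).1 (Γ j).2)

/-- The length `h_j` of the `j`-th segment. -/
def cutLength {n : ℕ} (Γ : Fin n → Plane × Plane) (j : Fin n) : ℝ := dist (Γ j).1 (Γ j).2

/-- The set of total lengths of the admissible cuts of `Ω` by `n(Ω)` segments; its minimum is the
constant `h(Ω)`. -/
def cutTotals (Ω : Set Plane) : Set ℝ :=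
  {L | ∃ Γ : Fin (numHoles Ω) → Plane × Plane, IsAdmissibleCut Ω Γ ∧ L = ∑ j, cutLength Γ j}

end

open Set Topology

/-! Off the cuts `A` is exact, `A = dφ`, because a closed form on a simply connected open set has a
primitive (`IsSimplyConnected.exists_forall_hasFDerivAt`). Test `λ₁` with `u = χ exp(iφ)`, where `χ`
is a real cutoff vanishing near the cuts: the gauge factor absorbs `A`, so `|∇ᴬu| = |∇χ|`, and the
jumps of `φ` across the cuts are invisible.

In the plane a small disc has small capacity, which is where the logarithms come from. With `l =
|ln(h/2)|` a cut of length `h` lies in the disc of radius `exp(-l) = h/2` about its midpoint. A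
cutoff rising in `ln r` between the radii `exp(-9l/10)` and `exp(-l/2)` has energy `6π/l`
(`integral_cutoffEnergy`). Multiplying `n` such cutoffs costs at most a factor `n` by Cauchy–Schwarz
(`sum_sq_prodCutoffDeriv_le`). The discs where `χ ≠ 1` have total area at most `Σ π h/2 ≤ |Ω|/4`, so
`∫|u|² ≥ 3|Ω|/4`, and `6π / (3/4) = 8π` (`lambdaOne_le_of_hasFDerivAt`). -/

/-! ### Closed forms on simply connected open sets -/

/-- The real line with the discrete topology. -/
structure DiscreteReal : Type where
  /-- The underlying real number. -/
  val : ℝ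

instance : TopologicalSpace DiscreteReal := ⊥

instance : DiscreteTopology DiscreteReal := ⟨rfl⟩

/-- This makes the transition functions between local primitives constant on overlaps of balls,
hence continuous for the discrete topology on the fibre. -/
theorem sub_eq_sub_of_hasFDerivAt {E : Type*} [NormedAddCommGroup E] [NormedSpace ℝ E]
    {s : Set E} (hs : Convex ℝ s) (hso : IsOpen s) {f g : E → ℝ} {α : E → E →L[ℝ] ℝ}
    (hf : ∀ x ∈ s, HasFDerivAt f (α x) x) (hg : ∀ x ∈ s, HasFDerivAt g (α x) x)
    {x y : E} (hx : x ∈ s) (hy : y ∈ s) : f x - g x = f y - g y := by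
  have hd : ∀ z ∈ s, HasFDerivAt (fun z ↦ f z - g z) (0 : E →L[ℝ] ℝ) z := fun z hz ↦ by
    simpa using! (hf z hz).sub (hg z hz)
  exact hs.is_const_of_fderivWithin_eq_zero (𝕜 := ℝ)
    (fun z hz ↦ (hd z hz).differentiableAt.differentiableWithinAt)
    (fun z hz ↦ (hd z hz).hasFDerivWithinAt.fderivWithin (hso.uniqueDiffWithinAt hz)) hx hy

/-- The bundle of germs of primitives of `α`, given local primitives on balls: the point `v` over
`x` in the chart `i` stands for the germ at `x` of `f i + v`. -/
def primitiveBundleCore {E : Type*} [NormedAddCommGroup E] [NormedSpace ℝ E]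
    (W : Set E) (α : E → E →L[ℝ] ℝ) (r : W → ℝ) (hr : ∀ i, 0 < r i) (f : W → E → ℝ)
    (hf : ∀ i : W, ∀ x ∈ Metric.ball (i : E) (r i), HasFDerivAt (f i) (α x) x) :
    FiberBundleCore W W DiscreteReal where
  baseSet i := {x | (x : E) ∈ Metric.ball (i : E) (r i)}
  isOpen_baseSet i := Metric.isOpen_ball.preimage continuous_subtype_val
  indexAt := id
  mem_baseSet_at x := Metric.mem_ball_self (hr x)
  coordChange i j x v := ⟨f i x - f j x + v.val⟩
  coordChange_self i x _ v := by
    simp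
  continuousOn_coordChange i j := by
    rintro ⟨x, v⟩ ⟨⟨hxi, hxj⟩, -⟩
    have hev : ∀ᶠ p : W × DiscreteReal in 𝓝 (x, v),
        ((p.1 : E) ∈ Metric.ball (i : E) (r i) ∩ Metric.ball (j : E) (r j)) ∧ p.2 = v := by
      rw [nhds_prod_eq, nhds_discrete DiscreteReal]
      exact (continuous_subtype_val.continuousAt.eventually_mem
        ((Metric.isOpen_ball.inter Metric.isOpen_ball).mem_nhds ⟨hxi, hxj⟩)).prod_mk
          (pa := fun y : W ↦ (y : E) ∈ Metric.ball (i : E) (r i) ∩ Metric.ball (j : E) (r j))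
          (Filter.eventually_pure.2 rfl : ∀ᶠ w in pure v, w = v)
    refine ContinuousAt.continuousWithinAt ?_
    refine (continuousAt_const (y := (⟨f i x - f j x + v.val⟩ : DiscreteReal))).congr ?_
    filter_upwards [hev] with p hp
    have := sub_eq_sub_of_hasFDerivAt
      ((convex_ball (i : E) (r i)).inter (convex_ball (j : E) (r j)))
      (Metric.isOpen_ball.inter Metric.isOpen_ball)
      (fun z hz ↦ hf i z hz.1) (fun z hz ↦ hf j z hz.2) ⟨hxi, hxj⟩ hp.1
    rw [hp.2, this]
  coordChange_comp i j k x _ v := by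
    congr 1
    ring

/-- A closed `1`-form on a simply connected open set is exact. -/
theorem IsSimplyConnected.exists_forall_hasFDerivAt {E : Type*} [NormedAddCommGroup E]
    [NormedSpace ℝ E] {W : Set E} (hW : IsSimplyConnected W) (hWo : IsOpen W)
    {α : E → E →L[ℝ] ℝ} (hα : DifferentiableOn ℝ α W)
    (hdα : ∀ a ∈ W, ∀ x y, fderiv ℝ α a x y = fderiv ℝ α a y x) :
    ∃ f : E → ℝ, ∀ a ∈ W, HasFDerivAt f (α a) a := by
  classical
  have hloc : ∀ i : W, ∃ r > 0, Metric.ball (i : E) r ⊆ W ∧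
      ∃ f : E → ℝ, ∀ x ∈ Metric.ball (i : E) r, HasFDerivAt f (α x) x := fun i ↦ by
    obtain ⟨r, hr, hrW⟩ := Metric.isOpen_iff.1 hWo i i.2
    exact ⟨r, hr, hrW, (convex_ball _ _).exists_forall_hasFDerivAt_of_fderiv_symmetric
      Metric.isOpen_ball (hα.mono hrW) fun a ha ↦ hdα a (hrW ha)⟩
  choose r hr hrW f hf using hloc
  have := hW.simplyConnectedSpace
  have := hWo.locallyPathConnectedSpace
  let Z := primitiveBundleCore W α r hr f hf
  have hcov : IsCoveringMap Z.proj := FiberBundle.isCoveringMap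
  obtain ⟨x₀, hx₀⟩ := hW.nonempty
  -- Discrete fibres make the bundle of germs a covering, so the identity of `W` lifts: the lift is
  -- a coherent global choice of germs of primitives.
  obtain ⟨s, ⟨-, hs⟩, -⟩ := hcov.existsUnique_continuousMap_lifts (ContinuousMap.id W)
    ⟨x₀, hx₀⟩ ⟨⟨x₀, hx₀⟩, (⟨0⟩ : DiscreteReal)⟩ rfl
  have hs1 : ∀ x, (s x).1 = x := fun x ↦ congrFun hs x
  let c : W → W → ℝ := fun j x ↦ ((Z.localTriv j) (s x)).2.val
  let φ : W → ℝ := fun x ↦ f x x + c x x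
  have hφ : ∀ j x : W, (x : E) ∈ Metric.ball (j : E) (r j) → φ x = f j x + c j x := by
    intro j x hx
    have hc : ∀ k : W, c k x = f x x - f k x + DiscreteReal.val (s x).2 := fun k ↦ by
      change f (s x).1 (s x).1 - f k (s x).1 + DiscreteReal.val (s x).2 = _
      rw [hs1]
    simp only [φ, hc]
    ring
  refine ⟨fun x ↦ if hx : x ∈ W then φ ⟨x, hx⟩ else 0, fun a ha ↦ ?_⟩
  let j : W := ⟨a, ha⟩
  have hcont : ContinuousAt (fun x : W ↦ ((Z.localTriv j) (s x)).2) j := by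
    have hmem : s j ∈ (Z.localTriv j).source := by
      rw [(Z.localTriv j).mem_source, ← FiberBundleCore.baseSet_at]
      change (s j).1 ∈ _
      rw [hs1]
      exact Metric.mem_ball_self (hr j)
    exact continuous_snd.continuousAt.comp
      (((Z.localTriv j).continuousAt hmem).comp s.continuous.continuousAt)
  -- A continuous map into a discrete space is locally constant, so near `a` the global function is
  -- `f j` plus a constant.
  have hconst : ∀ᶠ x : W in 𝓝 j, c j x = c j j := by
    have := hcont.eventually_mem (show {((Z.localTriv j) (s j)).2} ∈ 𝓝 _ by
      rw [nhds_discrete]; rfl)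
    filter_upwards [this] with x hx using congrArg DiscreteReal.val hx
  have hconst' : ∀ᶠ x in 𝓝 a, ∃ hx : x ∈ W, c j ⟨x, hx⟩ = c j j := by
    have := hconst
    rw [nhds_subtype_eq_comap, Filter.eventually_comap] at this
    filter_upwards [this, hWo.mem_nhds ha] with x hx hxW using ⟨hxW, hx ⟨x, hxW⟩ rfl⟩
  refine ((hf j a (Metric.mem_ball_self (hr j))).add_const (c j j)).congr_of_eventuallyEq ?_
  filter_upwards [hconst', Metric.ball_mem_nhds a (hr j)] with x ⟨hxW, hxc⟩ hxb
  simp only [hxW, dif_pos]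
  rw [hφ j ⟨x, hxW⟩ hxb, hxc]

/-! ### The cubic step -/

/-- The derivative of the cubic step function. -/
def stepDensity (t : ℝ) : ℝ := 6 * max 0 (t * (1 - t))

/-- The `C¹` step function that is `0` for `t ≤ 0`, `3t² - 2t³` on `[0, 1]` and `1` for `t ≥ 1`. -/
noncomputable def cubicStep (t : ℝ) : ℝ := ∫ s in 0..t, stepDensity s

@[fun_prop]
theorem continuous_stepDensity : Continuous stepDensity := by
  unfold stepDensity
  fun_prop

theorem stepDensity_nonneg (t : ℝ) : 0 ≤ stepDensity t := by
  unfold stepDensity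
  positivity

theorem stepDensity_le (t : ℝ) : stepDensity t ≤ 3 / 2 := by
  have : max 0 (t * (1 - t)) ≤ 1 / 4 := max_le (by norm_num) (by nlinarith [sq_nonneg (t - 1 / 2)])
  unfold stepDensity
  linarith

theorem stepDensity_of_nonpos {t : ℝ} (ht : t ≤ 0) : stepDensity t = 0 := by
  unfold stepDensity
  rw [max_eq_left (by nlinarith), mul_zero]

theorem stepDensity_of_one_le {t : ℝ} (ht : 1 ≤ t) : stepDensity t = 0 := by
  unfold stepDensity
  rw [max_eq_left (by nlinarith), mul_zero]

theorem stepDensity_of_mem_Icc {t : ℝ} (ht : t ∈ Icc (0 : ℝ) 1) :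
    stepDensity t = 6 * (t * (1 - t)) := by
  unfold stepDensity
  rw [max_eq_right (mul_nonneg ht.1 (sub_nonneg.2 ht.2))]

theorem hasDerivAt_cubicStep (t : ℝ) : HasDerivAt cubicStep (stepDensity t) t :=
  intervalIntegral.integral_hasDerivAt_right (continuous_stepDensity.intervalIntegrable _ _)
    continuous_stepDensity.stronglyMeasurable.stronglyMeasurableAtFilter
    continuous_stepDensity.continuousAt

theorem monotone_cubicStep : Monotone cubicStep :=
  monotone_of_hasDerivAt_nonneg hasDerivAt_cubicStep stepDensity_nonneg

theorem cubicStep_of_nonpos {t : ℝ} (ht : t ≤ 0) : cubicStep t = 0 := by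
  unfold cubicStep
  rw [intervalIntegral.integral_congr (g := fun _ ↦ 0) fun s hs ↦ ?_]
  · simp
  · rw [uIcc_of_ge ht] at hs
    exact stepDensity_of_nonpos hs.2

theorem cubicStep_one : cubicStep 1 = 1 := by
  unfold cubicStep
  rw [intervalIntegral.integral_congr (g := fun s ↦ 6 * (s * (1 - s))) fun s hs ↦ ?_,
    intervalIntegral.integral_eq_sub_of_hasDerivAt (f := fun s ↦ 3 * s ^ 2 - 2 * s ^ 3)
      (fun s _ ↦ ?_) (Continuous.intervalIntegrable (by fun_prop) _ _)]
  · norm_num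
  · refine (((hasDerivAt_pow 2 s).const_mul 3).sub
      ((hasDerivAt_pow 3 s).const_mul 2)).congr_deriv ?_
    norm_num
    ring
  · rw [uIcc_of_le zero_le_one] at hs
    exact stepDensity_of_mem_Icc hs

theorem cubicStep_of_one_le {t : ℝ} (ht : 1 ≤ t) : cubicStep t = 1 := by
  have h : cubicStep t = cubicStep 1 + ∫ s in 1..t, stepDensity s :=
    (intervalIntegral.integral_add_adjacent_intervals
      (continuous_stepDensity.intervalIntegrable _ _)
      (continuous_stepDensity.intervalIntegrable _ _)).symm
  rw [h, cubicStep_one, intervalIntegral.integral_congr (g := fun _ ↦ 0) fun s hs ↦ ?_]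
  · simp
  · rw [uIcc_of_le ht] at hs
    exact stepDensity_of_one_le hs.1

theorem cubicStep_nonneg (t : ℝ) : 0 ≤ cubicStep t := by
  rcases le_total t 0 with ht | ht
  · exact (cubicStep_of_nonpos ht).ge
  · exact (cubicStep_of_nonpos le_rfl).symm.trans_le (monotone_cubicStep ht)

theorem cubicStep_le_one (t : ℝ) : cubicStep t ≤ 1 := by
  rcases le_total t 1 with ht | ht
  · exact (monotone_cubicStep ht).trans_eq cubicStep_one
  · exact (cubicStep_of_one_le ht).le

theorem integral_stepDensity_sq : ∫ s in (0 : ℝ)..1, stepDensity s ^ 2 = 6 / 5 := by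
  rw [intervalIntegral.integral_congr (g := fun s ↦ (6 * (s * (1 - s))) ^ 2) fun s hs ↦ ?_,
    intervalIntegral.integral_eq_sub_of_hasDerivAt
      (f := fun s ↦ 12 * s ^ 3 - 18 * s ^ 4 + 36 / 5 * s ^ 5)
      (fun s _ ↦ ?_) (Continuous.intervalIntegrable (by fun_prop) _ _)]
  · norm_num
  · refine ((((hasDerivAt_pow 3 s).const_mul 12).sub ((hasDerivAt_pow 4 s).const_mul 18)).add
      ((hasDerivAt_pow 5 s).const_mul (36 / 5))).congr_deriv ?_
    norm_num
    ring
  · rw [uIcc_of_le zero_le_one] at hs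
    exact congrArg (· ^ 2) (stepDensity_of_mem_Icc hs)

/-! ### Energy of the radial cutoff -/

/-- The logarithmic scale on which the radius `exp (-9ℓ/10)` is `0` and `exp (-ℓ/2)` is `1`. -/
noncomputable def logScale (l r : ℝ) : ℝ := (Real.log r + 9 / 10 * l) / (2 / 5 * l)

theorem logScale_nonpos {l r : ℝ} (hl : 0 < l) (hr : 0 < r) (h : r ≤ Real.exp (-(9 / 10 * l))) :
    logScale l r ≤ 0 := by
  have := (Real.log_le_iff_le_exp hr).2 h
  exact div_nonpos_of_nonpos_of_nonneg (by linarith) (by positivity)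

theorem one_le_logScale {l r : ℝ} (hl : 0 < l) (h : Real.exp (-(l / 2)) ≤ r) :
    1 ≤ logScale l r := by
  have := (Real.le_log_iff_exp_le ((Real.exp_pos _).trans_le h)).2 h
  rw [logScale, one_le_div (by positivity)]
  linarith

theorem hasDerivAt_logScale (l : ℝ) {r : ℝ} (hr : r ≠ 0) :
    HasDerivAt (logScale l) (r⁻¹ / (2 / 5 * l)) r :=
  ((Real.hasDerivAt_log hr).add_const _).div_const _

/-- The squared gradient, at distance `r` of the centre, of the logarithmic cutoff. -/
noncomputable def cutoffEnergy (l r : ℝ) : ℝ := (stepDensity (logScale l r) / (2 / 5 * l * r)) ^ 2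

/-- The weight `r` of polar coordinates turns the energy density into an exact derivative in the
variable `logScale l r`. -/
theorem mul_cutoffEnergy {l r : ℝ} (hr : r ≠ 0) : r * cutoffEnergy l r =
    stepDensity (logScale l r) ^ 2 * (r⁻¹ / (2 / 5 * l)) / (2 / 5 * l) := by
  rw [cutoffEnergy]
  field_simp

theorem mul_cutoffEnergy_eq_zero {l r : ℝ} (hl : 0 < l)
    (hr : r ∈ Ioi 0 \ Ioc (Real.exp (-(9 / 10 * l))) (Real.exp (-(l / 2)))) :
    r * cutoffEnergy l r = 0 := by
  have h0 : stepDensity (logScale l r) = 0 := by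
    by_cases h : r ≤ Real.exp (-(9 / 10 * l))
    · exact stepDensity_of_nonpos (logScale_nonpos hl hr.1 h)
    · refine stepDensity_of_one_le (one_le_logScale hl ?_)
      by_contra! h'
      exact hr.2 ⟨not_le.1 h, h'.le⟩
  simp [cutoffEnergy, h0]

theorem continuousOn_mul_cutoffEnergy (l : ℝ) :
    ContinuousOn (fun r ↦ stepDensity (logScale l r) ^ 2 * (r⁻¹ / (2 / 5 * l)) / (2 / 5 * l))
      (Ioi 0) := by
  have h1 : ContinuousOn (logScale l) (Ioi 0) := fun r hr ↦
    (hasDerivAt_logScale l (ne_of_gt hr)).continuousAt.continuousWithinAt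
  have h2 : ContinuousOn (fun r : ℝ ↦ r⁻¹) (Ioi 0) :=
    continuousOn_inv₀.mono fun r hr ↦ ne_of_gt hr
  exact (((continuous_stepDensity.comp_continuousOn h1).pow 2).mul (h2.div_const _)).div_const _

theorem uIcc_exp_subset_Ioi (a b : ℝ) : uIcc (Real.exp a) (Real.exp b) ⊆ Ioi 0 := fun _ hr ↦
  (lt_inf_iff.2 ⟨Real.exp_pos a, Real.exp_pos b⟩).trans_le hr.1

theorem intervalIntegrable_mul_cutoffEnergy (l a b : ℝ) :
    IntervalIntegrable (fun r ↦ r * cutoffEnergy l r) volume (Real.exp a) (Real.exp b) :=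
  (((continuousOn_mul_cutoffEnergy l).congr fun _ hr ↦ mul_cutoffEnergy (ne_of_gt hr)).mono
    (uIcc_exp_subset_Ioi a b)).intervalIntegrable

/-- Substituting `t = logScale l r` leaves `∫₀¹ stepDensity² = 6/5`, divided by the logarithmic
width `2l/5`. -/
theorem integral_mul_cutoffEnergy {l : ℝ} (hl : 0 < l) :
    ∫ r in Real.exp (-(9 / 10 * l))..Real.exp (-(l / 2)), r * cutoffEnergy l r = 3 / l := by
  have hK : ∀ t : ℝ, HasDerivAt (fun t ↦ ∫ s in 0..t, stepDensity s ^ 2) (stepDensity t ^ 2) t :=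
    fun t ↦ by
      have hc : Continuous fun s ↦ stepDensity s ^ 2 := by fun_prop
      exact intervalIntegral.integral_hasDerivAt_right (hc.intervalIntegrable _ _)
        hc.stronglyMeasurable.stronglyMeasurableAtFilter hc.continuousAt
  rw [intervalIntegral.integral_eq_sub_of_hasDerivAt
    (f := fun r ↦ (∫ s in 0..logScale l r, stepDensity s ^ 2) / (2 / 5 * l)) (fun r hr ↦ ?_)
    (intervalIntegrable_mul_cutoffEnergy _ _ _)]
  · have h0 : logScale l (Real.exp (-(9 / 10 * l))) = 0 := by simp [logScale]
    have h1 : logScale l (Real.exp (-(l / 2))) = 1 := by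
      rw [logScale, Real.log_exp]
      field_simp
      norm_num
    simp only [h0, h1, integral_stepDensity_sq, intervalIntegral.integral_same]
    field_simp
    norm_num
  · have hr0 : r ≠ 0 := ne_of_gt (uIcc_exp_subset_Ioi _ _ hr)
    rw [mul_cutoffEnergy hr0]
    exact ((hK _).comp r (hasDerivAt_logScale l hr0)).div_const _

theorem integrableOn_mul_cutoffEnergy {l : ℝ} (hl : 0 < l) :
    IntegrableOn (fun r ↦ r * cutoffEnergy l r) (Ioi 0) :=
  (((intervalIntegrable_iff_integrableOn_Ioc_of_le (Real.exp_le_exp.2 (by linarith))).1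
    (intervalIntegrable_mul_cutoffEnergy l (-(9 / 10 * l)) (-(l / 2))))).of_forall_sdiff_eq_zero
      measurableSet_Ioi fun _ ↦ mul_cutoffEnergy_eq_zero hl

theorem integrable_cutoffEnergy {l : ℝ} (hl : 0 < l) (m : Plane) :
    Integrable fun x : Plane ↦ cutoffEnergy l ‖x - m‖ := by
  have : Integrable fun x : Plane ↦ cutoffEnergy l ‖x‖ := by
    rw [integrable_fun_norm_addHaar]
    simpa using integrableOn_mul_cutoffEnergy hl
  exact this.comp_sub_right m

theorem integral_cutoffEnergy {l : ℝ} (hl : 0 < l) (m : Plane) :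
    ∫ x : Plane, cutoffEnergy l ‖x - m‖ = 6 * Real.pi / l := by
  rw [integral_sub_right_eq_self (fun x : Plane ↦ cutoffEnergy l ‖x‖) m,
    integral_fun_norm_addHaar]
  have h : ∫ r in Ioi 0, r * cutoffEnergy l r = 3 / l := by
    rw [← integral_mul_cutoffEnergy hl,
      intervalIntegral.integral_of_le (Real.exp_le_exp.2 (by linarith))]
    exact setIntegral_eq_of_subset_of_forall_sdiff_eq_zero measurableSet_Ioi
      (fun r hr ↦ (Real.exp_pos _).trans hr.1) fun _ ↦ mul_cutoffEnergy_eq_zero hl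
  simp only [finrank_euclideanSpace, Fintype.card_fin, Nat.add_one_sub_one, pow_one, smul_eq_mul, h,
    measureReal_def, EuclideanSpace.volume_ball_fin_two]
  simp [Real.pi_nonneg]
  ring

/-! ### The cutoff in the plane -/

open Classical in
/-- The logarithmic cutoff around `m`, vanishing up to the radius `exp (-9ℓ/10)` and equal to `1`
from the radius `exp (-ℓ/2)` on. -/
noncomputable def logCutoff (l : ℝ) (m x : Plane) : ℝ :=
  -- The centre is separate because `Real.log 0 = 0` would give `logScale l 0 = 9/4` for `l > 0`,
  -- hence the value `1`.
  if x = m then 0 else cubicStep (logScale l ‖x - m‖)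

theorem logCutoff_eq_zero {l : ℝ} (hl : 0 < l) {m x : Plane}
    (h : ‖x - m‖ ≤ Real.exp (-(9 / 10 * l))) : logCutoff l m x = 0 := by
  unfold logCutoff
  split_ifs with hx
  · rfl
  · exact cubicStep_of_nonpos (logScale_nonpos hl (norm_pos_iff.2 (sub_ne_zero.2 hx)) h)

theorem logCutoff_eq_one {l : ℝ} (hl : 0 < l) {m x : Plane}
    (h : Real.exp (-(l / 2)) ≤ ‖x - m‖) : logCutoff l m x = 1 := by
  unfold logCutoff
  rw [if_neg]
  · exact cubicStep_of_one_le (one_le_logScale hl h)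
  · rintro rfl
    rw [sub_self, norm_zero] at h
    exact (Real.exp_pos _).not_ge h

theorem logCutoff_nonneg (l : ℝ) (m x : Plane) : 0 ≤ logCutoff l m x := by
  unfold logCutoff
  split_ifs
  · rfl
  · exact cubicStep_nonneg _

theorem logCutoff_le_one (l : ℝ) (m x : Plane) : logCutoff l m x ≤ 1 := by
  unfold logCutoff
  split_ifs
  · exact zero_le_one
  · exact cubicStep_le_one _

theorem logCutoff_eventuallyEq_zero {l : ℝ} (hl : 0 < l) {m x : Plane}
    (h : ‖x - m‖ < Real.exp (-(9 / 10 * l))) : logCutoff l m =ᶠ[𝓝 x] 0 := by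
  have : ∀ᶠ y in 𝓝 x, ‖y - m‖ < Real.exp (-(9 / 10 * l)) :=
    (by fun_prop : ContinuousAt (fun y : Plane ↦ ‖y - m‖) x).eventually_lt_const h
  filter_upwards [this] with y hy using logCutoff_eq_zero hl hy.le

/-- The derivative of the logarithmic cutoff. -/
noncomputable def logCutoffDeriv (l : ℝ) (m x : Plane) : Plane →L[ℝ] ℝ :=
  (stepDensity (logScale l ‖x - m‖) / (2 / 5 * l * ‖x - m‖ ^ 2)) • innerSL ℝ (x - m)

theorem hasFDerivAt_logCutoff {l : ℝ} (hl : 0 < l) (m x : Plane) :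
    HasFDerivAt (logCutoff l m) (logCutoffDeriv l m x) x := by
  by_cases hx : x = m
  · have h0 : logCutoffDeriv l m x = 0 := by simp [logCutoffDeriv, hx]
    rw [h0]
    refine (hasFDerivAt_const (0 : ℝ) x).congr_of_eventuallyEq ?_
    exact logCutoff_eventuallyEq_zero hl (by simpa [hx] using Real.exp_pos _)
  · have hn : ‖x - m‖ ≠ 0 := norm_ne_zero_iff.2 (sub_ne_zero.2 hx)
    have hnorm : HasFDerivAt (fun y : Plane ↦ ‖y - m‖) (‖x - m‖⁻¹ • innerSL ℝ (x - m)) x := by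
      have h1 : HasFDerivAt (fun y : Plane ↦ ‖y - m‖ ^ 2) (2 • innerSL ℝ (x - m)) x := by
        simpa using! ((hasFDerivAt_id x).sub_const m).norm_sq
      have h2 := h1.sqrt (by positivity)
      simp only [Real.sqrt_sq (norm_nonneg _)] at h2
      refine h2.congr_fderiv ?_
      ext v
      simp
      field_simp
    have h := ((hasDerivAt_cubicStep _).comp _ (hasDerivAt_logScale l hn)).comp_hasFDerivAt x hnorm
    refine (h.congr_of_eventuallyEq ?_).congr_fderiv ?_
    · filter_upwards [isOpen_ne.mem_nhds hx] with y hy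
      simp only [logCutoff, if_neg hy, Function.comp_def]
    · ext v
      simp [logCutoffDeriv]
      field_simp

theorem sum_sq_apply_stdVec_innerSL (y : Plane) :
    ∑ j, innerSL ℝ y (stdVec j) ^ 2 = ‖y‖ ^ 2 := by
  rw [EuclideanSpace.norm_sq_eq]
  simp [stdVec, EuclideanSpace.inner_single_right]

theorem sum_sq_logCutoffDeriv (l : ℝ) (m x : Plane) :
    ∑ j, logCutoffDeriv l m x (stdVec j) ^ 2 = cutoffEnergy l ‖x - m‖ := by
  simp only [logCutoffDeriv, smul_apply, smul_eq_mul, mul_pow,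
    ← Finset.mul_sum, sum_sq_apply_stdVec_innerSL, cutoffEnergy]
  by_cases hn : ‖x - m‖ = 0
  · simp [hn]
  · field_simp

/-- The density vanishes on the inner disc, so `1/r` stays bounded. Only boundedness matters: it
puts the trial function in `H¹`. -/
theorem cutoffEnergy_le {l r : ℝ} (hl : 0 < l) (hr : 0 ≤ r) :
    cutoffEnergy l r ≤ (3 / 2 / (2 / 5 * l * Real.exp (-(9 / 10 * l)))) ^ 2 := by
  by_cases h : r ≤ Real.exp (-(9 / 10 * l))
  · have : cutoffEnergy l r = 0 := by
      rcases hr.eq_or_lt with rfl | hr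
      · simp [cutoffEnergy]
      · simp [cutoffEnergy, stepDensity_of_nonpos (logScale_nonpos hl hr h)]
    rw [this]
    positivity
  · unfold cutoffEnergy
    have h1 := stepDensity_le (logScale l r)
    have h2 := stepDensity_nonneg (logScale l r)
    have h3 := (not_le.1 h).le
    gcongr

/-! ### Trial functions -/

theorem integral_fderiv_apply_eq_zero {E : Type*} [NormedAddCommGroup E] [NormedSpace ℝ E]
    [FiniteDimensional ℝ E] [MeasurableSpace E] [BorelSpace E] {μ : Measure E}
    [μ.IsAddHaarMeasure] {w : E → ℂ} {v : E} (hw : Differentiable ℝ w) (hwi : Integrable w μ)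
    (hwi' : Integrable (fun x ↦ fderiv ℝ w x v) μ) : ∫ x, fderiv ℝ w x v ∂μ = 0 := by
  have := integral_smul_fderiv_eq_neg_fderiv_smul_of_integrable (μ := μ) (𝕜 := ℝ)
    (f := fun _ ↦ (1 : ℝ)) (g := w) (v := v) (by simp) (by simpa using hwi') (by simpa using hwi)
    (by fun_prop) fun x _ ↦ hw x
  simpa using this

/-- On an open set, the classical partial derivatives of a differentiable function are weak
partial derivatives, as soon as they are integrable. -/
theorem isWeakPartialDeriv_fderiv {Ω : Set Plane} (hΩ : IsOpen Ω) (j : Fin 2) {u : Plane → ℂ}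
    (hu : ∀ x ∈ Ω, DifferentiableAt ℝ u x) (hui : IntegrableOn u Ω)
    (hui' : IntegrableOn (fun x ↦ fderiv ℝ u x (stdVec j)) Ω) :
    IsWeakPartialDeriv Ω j u fun x ↦ fderiv ℝ u x (stdVec j) := by
  intro φ hφ hφc hφs
  have hφd : Differentiable ℝ φ := hφ.differentiable (by simp)
  have hφ'c : Continuous fun x ↦ fderiv ℝ φ x (stdVec j) :=
    (hφ.continuous_fderiv (by simp)).clm_apply continuous_const
  obtain ⟨C, hC⟩ := hφc.exists_bound_of_continuous hφ.continuous
  obtain ⟨C', hC'⟩ := (hφc.fderiv_apply (𝕜 := ℝ) (stdVec j)).exists_bound_of_continuous hφ'c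
  have hzero : ∀ x ∉ Ω, φ x • u x = 0 := fun x hx ↦ by
    rw [image_eq_zero_of_notMem_tsupport fun h ↦ hx (hφs h), zero_smul]
  have hnear : ∀ x ∉ tsupport φ, (fun x ↦ φ x • u x) =ᶠ[𝓝 x] 0 := fun x hx ↦ by
    filter_upwards [(isClosed_tsupport φ).isOpen_compl.mem_nhds hx] with y hy
    rw [image_eq_zero_of_notMem_tsupport hy, zero_smul, Pi.zero_apply]
  have hderiv : ∀ x ∈ Ω, fderiv ℝ (fun x ↦ φ x • u x) x (stdVec j) =
      φ x • fderiv ℝ u x (stdVec j) + fderiv ℝ φ x (stdVec j) • u x := fun x hx ↦ by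
    rw [fderiv_fun_smul (hφd x) (hu x hx)]
    simp
  have hderiv0 : ∀ x ∉ Ω, fderiv ℝ (fun x ↦ φ x • u x) x (stdVec j) = 0 := fun x hx ↦ by
    rw [(hnear x fun h ↦ hx (hφs h)).fderiv_eq]
    simp
  -- The support of `φ` lies in `Ω`, so `φ u` is differentiable on the whole plane whatever `u` does
  -- outside `Ω`, and no boundary term appears.
  have hwd : Differentiable ℝ fun x ↦ φ x • u x := fun x ↦ by
    by_cases hx : x ∈ tsupport φ
    · exact (hφd x).smul (hu x (hφs hx))
    · exact (hnear x hx).differentiableAt_iff.2 (differentiableAt_const 0)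
  have i1 : IntegrableOn (fun x ↦ φ x • u x) Ω :=
    Integrable.bdd_smul hui C hφ.continuous.aestronglyMeasurable (.of_forall hC)
  have i2 : IntegrableOn (fun x ↦ φ x • fderiv ℝ u x (stdVec j)) Ω :=
    Integrable.bdd_smul hui' C hφ.continuous.aestronglyMeasurable (.of_forall hC)
  have i3 : IntegrableOn (fun x ↦ fderiv ℝ φ x (stdVec j) • u x) Ω :=
    Integrable.bdd_smul hui C' hφ'c.aestronglyMeasurable (.of_forall hC')
  have key := integral_fderiv_apply_eq_zero (μ := volume) (v := stdVec j) hwd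
    ((integrableOn_iff_integrable_of_support_subset fun x hx ↦ by_contra fun h ↦ hx (hzero x h)).1
      i1)
    ((integrableOn_iff_integrable_of_support_subset fun x hx ↦ by_contra fun h ↦ hx (hderiv0 x h)).1
      ((i2.add i3).congr_fun (fun x hx ↦ (hderiv x hx).symm) hΩ.measurableSet))
  rw [← setIntegral_eq_integral_of_forall_compl_eq_zero (s := Ω) hderiv0,
    setIntegral_congr_fun hΩ.measurableSet hderiv, integral_add i2 i3] at key
  exact eq_neg_of_add_eq_zero_right key

theorem magneticGradSq_nonneg (A : Plane → (Plane →L[ℝ] ℝ)) (u : Plane → ℂ)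
    (g : Fin 2 → Plane → ℂ) (x : Plane) : 0 ≤ magneticGradSq A u g x :=
  Finset.sum_nonneg fun _ _ ↦ sq_nonneg _

/-- A bounded differentiable function with bounded derivatives is a trial function for `λ₁`. -/
theorem lambdaOne_le_of_differentiableAt {Ω : Set Plane} (hΩ : IsOpen Ω)
    (hΩb : Bornology.IsBounded Ω) (A : Plane → (Plane →L[ℝ] ℝ)) {u : Plane → ℂ} {B C : ℝ}
    (hu : ∀ x ∈ Ω, DifferentiableAt ℝ u x) (hB : ∀ x ∈ Ω, ‖u x‖ ≤ B)
    (hC : ∀ x ∈ Ω, ∀ j, ‖fderiv ℝ u x (stdVec j)‖ ≤ C) (h0 : 0 < ∫ x in Ω, ‖u x‖ ^ 2) :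
    lambdaOne Ω A ≤ (∫ x in Ω, magneticGradSq A u (fun j x ↦ fderiv ℝ u x (stdVec j)) x) /
      ∫ x in Ω, ‖u x‖ ^ 2 := by
  have : IsFiniteMeasure (volume.restrict Ω) := ⟨by
    rw [Measure.restrict_apply_univ]
    exact hΩb.measure_lt_top⟩
  have hum : AEStronglyMeasurable u (volume.restrict Ω) :=
    ContinuousOn.aestronglyMeasurable (fun x hx ↦ (hu x hx).continuousAt.continuousWithinAt)
      hΩ.measurableSet
  have hu2 : MemLp u 2 (volume.restrict Ω) :=
    MemLp.of_bound hum B (ae_restrict_of_forall_mem hΩ.measurableSet hB)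
  have hg2 : ∀ j, MemLp (fun x ↦ fderiv ℝ u x (stdVec j)) 2 (volume.restrict Ω) := fun j ↦
    MemLp.of_bound (measurable_fderiv_apply_const ℝ u (stdVec j)).aestronglyMeasurable C
      (ae_restrict_of_forall_mem hΩ.measurableSet fun x hx ↦ hC x hx j)
  refine csInf_le ⟨0, ?_⟩ ⟨u, fun j x ↦ fderiv ℝ u x (stdVec j), ⟨hu2, hg2, fun j ↦ ?_⟩, ?_, rfl⟩
  · rintro _ ⟨v, g, -, -, rfl⟩
    exact div_nonneg (integral_nonneg (magneticGradSq_nonneg A v g))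
      (integral_nonneg fun x ↦ sq_nonneg _)
  · exact isWeakPartialDeriv_fderiv hΩ j hu (hu2.integrable one_le_two)
      ((hg2 j).integrable one_le_two)
  · intro hu0
    refine h0.ne' (integral_eq_zero_of_ae ?_)
    filter_upwards [hu0] with x hx
    simp [hx]

/-- The gauge factor `exp (i φ)` with `dφ = A` turns the cutoff `χ` into a trial function, whose
magnetic gradient is the gradient of `χ`. -/
theorem hasFDerivAt_ofReal_mul_exp {E : Type*} [NormedAddCommGroup E] [NormedSpace ℝ E]
    {χ φ : E → ℝ} {D a : E →L[ℝ] ℝ} {x : E} (hχ : HasFDerivAt χ D x)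
    (h : HasFDerivAt φ a x ∨ χ =ᶠ[𝓝 x] 0) :
    HasFDerivAt (fun y ↦ (χ y : ℂ) * Complex.exp (φ y * Complex.I))
      (Complex.exp (φ x * Complex.I) •
        (Complex.ofRealCLM.comp D + (χ x * Complex.I) • Complex.ofRealCLM.comp a)) x := by
  rcases h with hφ | h0
  · have h1 : HasFDerivAt (fun y ↦ (χ y : ℂ)) (Complex.ofRealCLM.comp D) x :=
      Complex.ofRealCLM.hasFDerivAt.comp x hχ
    have h2 : HasFDerivAt (fun y ↦ (φ y : ℂ)) (Complex.ofRealCLM.comp a) x :=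
      Complex.ofRealCLM.hasFDerivAt.comp x hφ
    refine (h1.mul (h2.mul_const Complex.I).cexp).congr_fderiv ?_
    ext v
    simp
    ring
  · have hD : D = 0 := hχ.unique ((hasFDerivAt_const (0 : ℝ) x).congr_of_eventuallyEq h0)
    have hx : χ x = 0 := h0.self_of_nhds
    rw [hD, hx]
    refine ((hasFDerivAt_const (0 : ℂ) x).congr_of_eventuallyEq ?_).congr_fderiv ?_
    · filter_upwards [h0] with y hy
      simp [hy]
    · ext v
      simp

/-! ### The product cutoff and its Rayleigh quotient -/

/-- The derivative of a product of logarithmic cutoffs. -/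
noncomputable def prodCutoffDeriv {n : ℕ} (l : Fin n → ℝ) (m : Fin n → Plane) (x : Plane) :
    Plane →L[ℝ] ℝ :=
  ∑ k, (∏ i ∈ Finset.univ.erase k, logCutoff (l i) (m i) x) • logCutoffDeriv (l k) (m k) x

/-- Cauchy–Schwarz over the `n` terms of the Leibniz rule gives the factor `n`; the remaining
cutoffs in each term lie in `[0, 1]`. -/
theorem sum_sq_prodCutoffDeriv_le {n : ℕ} (l : Fin n → ℝ) (m : Fin n → Plane) (x : Plane) :
    ∑ j, prodCutoffDeriv l m x (stdVec j) ^ 2 ≤ n * ∑ k, cutoffEnergy (l k) ‖x - m k‖ := by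
  have h (j : Fin 2) : prodCutoffDeriv l m x (stdVec j) ^ 2 ≤
      n * ∑ k, logCutoffDeriv (l k) (m k) x (stdVec j) ^ 2 := by
    simp only [prodCutoffDeriv, sum_apply, smul_apply, smul_eq_mul]
    refine sq_sum_le_card_mul_sum_sq.trans ?_
    rw [Finset.card_univ, Fintype.card_fin]
    refine mul_le_mul_of_nonneg_left (Finset.sum_le_sum fun k _ ↦ ?_) n.cast_nonneg
    rw [mul_pow]
    refine mul_le_of_le_one_left (sq_nonneg _) (pow_le_one₀ ?_ ?_)
    · exact Finset.prod_nonneg fun i _ ↦ logCutoff_nonneg _ _ _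
    · exact Finset.prod_le_one (fun i _ ↦ logCutoff_nonneg _ _ _) fun i _ ↦ logCutoff_le_one _ _ _
  refine (Finset.sum_le_sum fun j _ ↦ h j).trans_eq ?_
  rw [← Finset.mul_sum, Finset.sum_comm]
  simp only [sum_sq_logCutoffDeriv]

/-- If `A` is exact off finitely many small discs, then `λ₁(Ω, A)` is bounded by the energy of the
product of the logarithmic cutoffs around these discs. -/
theorem lambdaOne_le_of_hasFDerivAt {Ω : Set Plane} (hΩ : IsOpen Ω)
    (hΩb : Bornology.IsBounded Ω) {A : Plane → (Plane →L[ℝ] ℝ)}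
    (hA : ContinuousOn A (closure Ω)) {n : ℕ} {l : Fin n → ℝ} {m : Fin n → Plane}
    (hl : ∀ k, 0 < l k) {φ : Plane → ℝ}
    (hφ : ∀ x ∈ Ω, (∀ k, Real.exp (-(9 / 10 * l k)) ≤ ‖x - m k‖) → HasFDerivAt φ (A x) x)
    (hpos : 0 < volume.real Ω)
    (hsum : ∑ k, Real.pi * Real.exp (-(l k)) ≤ volume.real Ω / 4) :
    lambdaOne Ω A ≤ 8 * Real.pi * n / volume.real Ω * ∑ k, 1 / l k := by
  classical
  have hfin : volume Ω ≠ ⊤ := hΩb.measure_lt_top.ne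
  have : IsFiniteMeasure (volume.restrict Ω) := ⟨by
    rw [Measure.restrict_apply_univ]
    exact hfin.lt_top⟩
  let χ : Plane → ℝ := fun x ↦ ∏ k, logCutoff (l k) (m k) x
  have hχd : ∀ x, HasFDerivAt χ (prodCutoffDeriv l m x) x := fun x ↦
    HasFDerivAt.finsetProd fun k _ ↦ hasFDerivAt_logCutoff (hl k) (m k) x
  have hχ0 : ∀ x, 0 ≤ χ x := fun x ↦ Finset.prod_nonneg fun i _ ↦ logCutoff_nonneg _ _ _
  have hχ1 : ∀ x, χ x ≤ 1 := fun x ↦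
    Finset.prod_le_one (fun i _ ↦ logCutoff_nonneg _ _ _) fun i _ ↦ logCutoff_le_one _ _ _
  let u : Plane → ℂ := fun x ↦ χ x * Complex.exp (φ x * Complex.I)
  have hun : ∀ x, ‖u x‖ = χ x := fun x ↦ by
    simp [u, Complex.norm_exp_ofReal_mul_I, abs_of_nonneg (hχ0 x)]
  have hud : ∀ x ∈ Ω, HasFDerivAt u (Complex.exp (φ x * Complex.I) •
      (Complex.ofRealCLM.comp (prodCutoffDeriv l m x) +
        (χ x * Complex.I) • Complex.ofRealCLM.comp (A x))) x := fun x hx ↦ by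
    refine hasFDerivAt_ofReal_mul_exp (hχd x) ?_
    by_cases h : ∀ k, Real.exp (-(9 / 10 * l k)) ≤ ‖x - m k‖
    · exact .inl (hφ x hx h)
    · push Not at h
      obtain ⟨k, hk⟩ := h
      right
      filter_upwards [logCutoff_eventuallyEq_zero (hl k) hk] with y hy
      exact Finset.prod_eq_zero (Finset.mem_univ k) hy
  have huf : ∀ x ∈ Ω, ∀ j, fderiv ℝ u x (stdVec j) = Complex.exp (φ x * Complex.I) *
      (prodCutoffDeriv l m x (stdVec j) + χ x * Complex.I * A x (stdVec j)) := fun x hx j ↦ by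
    rw [(hud x hx).fderiv]
    simp [mul_add]
  obtain ⟨K, hK⟩ := hΩb.isCompact_closure.exists_bound_of_continuousOn hA
  let M : ℝ := n * ∑ k, (3 / 2 / (2 / 5 * l k * Real.exp (-(9 / 10 * l k)))) ^ 2
  have hM : ∀ x j, |prodCutoffDeriv l m x (stdVec j)| ≤ √M := fun x j ↦ by
    refine Real.abs_le_sqrt ?_
    refine (Finset.single_le_sum (f := fun j ↦ prodCutoffDeriv l m x (stdVec j) ^ 2)
      (fun _ _ ↦ sq_nonneg _) (Finset.mem_univ j)).trans
      ((sum_sq_prodCutoffDeriv_le l m x).trans ?_)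
    simp only [M]
    gcongr with k
    exact cutoffEnergy_le (hl k) (norm_nonneg _)
  have hbound : ∀ x ∈ Ω, ∀ j, ‖fderiv ℝ u x (stdVec j)‖ ≤ √M + K := fun x hx j ↦ by
    have h1 : |A x (stdVec j)| ≤ K := by
      refine ((A x).le_opNorm _).trans ?_
      simpa [stdVec] using hK x (subset_closure hx)
    rw [huf x hx, norm_mul, Complex.norm_exp_ofReal_mul_I, one_mul]
    refine (norm_add_le _ _).trans (add_le_add ?_ ?_)
    · simpa using hM x j
    · simp only [norm_mul, Complex.norm_real, Complex.norm_I, mul_one, Real.norm_eq_abs,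
        abs_of_nonneg (hχ0 x)]
      exact (mul_le_of_le_one_left (abs_nonneg _) (hχ1 x)).trans h1
  have hmag : ∀ x ∈ Ω, magneticGradSq A u (fun j x ↦ fderiv ℝ u x (stdVec j)) x ≤
      n * ∑ k, cutoffEnergy (l k) ‖x - m k‖ := fun x hx ↦ by
    refine le_trans (le_of_eq ?_) (sum_sq_prodCutoffDeriv_le l m x)
    refine Finset.sum_congr rfl fun j _ ↦ ?_
    -- The gauge cancellation: `A` disappears, leaving a phase times the derivative of `χ`.
    have : fderiv ℝ u x (stdVec j) - Complex.I * u x * (A x (stdVec j) : ℂ) =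
        Complex.exp (φ x * Complex.I) * (prodCutoffDeriv l m x (stdVec j) : ℝ) := by
      rw [huf x hx]
      ring
    rw [this, norm_mul, Complex.norm_exp_ofReal_mul_I, one_mul, Complex.norm_real,
      Real.norm_eq_abs, sq_abs]
  have hupper : ∫ x in Ω, magneticGradSq A u (fun j x ↦ fderiv ℝ u x (stdVec j)) x ≤
      n * ∑ k, 6 * Real.pi / l k := by
    have hi : Integrable fun x : Plane ↦ (n : ℝ) * ∑ k, cutoffEnergy (l k) ‖x - m k‖ :=
      (integrable_finsetSum _ fun k _ ↦ integrable_cutoffEnergy (hl k) (m k)).const_mul _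
    calc _ ≤ ∫ x in Ω, (n : ℝ) * ∑ k, cutoffEnergy (l k) ‖x - m k‖ :=
          integral_mono_of_nonneg (.of_forall (magneticGradSq_nonneg _ _ _)) hi.integrableOn
            (ae_restrict_of_forall_mem hΩ.measurableSet hmag)
      _ ≤ ∫ x, (n : ℝ) * ∑ k, cutoffEnergy (l k) ‖x - m k‖ :=
          setIntegral_le_integral hi (.of_forall fun x ↦
            mul_nonneg n.cast_nonneg (Finset.sum_nonneg fun k _ ↦ sq_nonneg _))
      _ = _ := by
          rw [integral_const_mul, integral_finsetSum _ fun k _ ↦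
            integrable_cutoffEnergy (hl k) (m k)]
          simp only [integral_cutoffEnergy (hl _)]
  have hlower : 3 / 4 * volume.real Ω ≤ ∫ x in Ω, ‖u x‖ ^ 2 := by
    -- Off these discs `χ = 1`; each has area `π exp(-l k)`, the quantity controlled by `hsum`.
    let S : Set Plane := ⋃ k, Metric.ball (m k) (Real.exp (-(l k / 2)))
    have hSo : IsOpen S := isOpen_iUnion fun k ↦ Metric.isOpen_ball
    have hS : volume.real S ≤ volume.real Ω / 4 := by
      refine (measureReal_iUnion_fintype_le _).trans (le_trans (le_of_eq ?_) hsum)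
      refine Finset.sum_congr rfl fun k _ ↦ ?_
      rw [measureReal_def, EuclideanSpace.volume_ball_fin_two, ENNReal.toReal_mul,
        ENNReal.toReal_pow, ENNReal.toReal_ofReal (Real.exp_pos _).le,
        ENNReal.toReal_ofReal Real.pi_nonneg, ← Real.exp_nat_mul, mul_comm]
      congr 2
      push_cast
      ring
    have hui : IntegrableOn (fun x ↦ ‖u x‖ ^ 2) Ω := by
      have hc : Continuous χ := continuous_iff_continuousAt.2 fun x ↦ (hχd x).continuousAt
      simp only [hun]
      refine Integrable.of_bound (hc.pow 2).aestronglyMeasurable 1 (.of_forall fun x ↦ ?_)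
      rw [Real.norm_of_nonneg (sq_nonneg _)]
      exact pow_le_one₀ (hχ0 x) (hχ1 x)
    have hSfin : volume S ≠ ⊤ := by
      refine ((measure_iUnion_le _).trans_lt ?_).ne
      rw [tsum_fintype]
      exact ENNReal.sum_lt_top.2 fun k _ ↦ measure_ball_lt_top
    calc 3 / 4 * volume.real Ω ≤ volume.real Ω - volume.real S := by linarith
      _ ≤ volume.real (Ω \ S) := le_measureReal_sdiff hSfin
      _ = ∫ x in Ω \ S, (1 : ℝ) := by simp
      _ = ∫ x in Ω \ S, ‖u x‖ ^ 2 := by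
          refine setIntegral_congr_fun (hΩ.measurableSet.diff hSo.measurableSet) fun x hx ↦ ?_
          have : χ x = 1 := Finset.prod_eq_one fun k _ ↦ logCutoff_eq_one (hl k) (by
            have : x ∉ Metric.ball (m k) _ := fun h ↦ hx.2 (mem_iUnion.2 ⟨k, h⟩)
            rwa [mem_ball_iff_norm, not_lt] at this)
          simp [hun, this]
      _ ≤ _ := setIntegral_mono_set hui (.of_forall fun x ↦ sq_nonneg _)
          (Filter.Eventually.of_forall fun x hx ↦ hx.1)
  have h0 : 0 < ∫ x in Ω, ‖u x‖ ^ 2 := by linarith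
  refine (lambdaOne_le_of_differentiableAt hΩ hΩb A (B := 1)
    (fun x hx ↦ (hud x hx).differentiableAt) (fun x _ ↦ (hun x).trans_le (hχ1 x)) hbound h0).trans ?_
  have hT : 0 ≤ ∑ k, 1 / l k := Finset.sum_nonneg fun k _ ↦ (one_div_pos.2 (hl k)).le
  have hsplit : ∑ k, 6 * Real.pi / l k = 6 * Real.pi * ∑ k, 1 / l k := by
    rw [Finset.mul_sum]
    simp only [mul_one_div]
  rw [hsplit] at hupper
  rw [div_le_iff₀ h0]
  calc _ ≤ _ := hupper
    _ = 8 * Real.pi * n / volume.real Ω * (∑ k, 1 / l k) * (3 / 4 * volume.real Ω) := by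
        field_simp
        ring
    _ ≤ _ := by
        have := Real.pi_pos
        gcongr

/-! ### Application to admissible cuts -/

theorem segment_subset_ball_midpoint {E : Type*} [NormedAddCommGroup E] [NormedSpace ℝ E]
    (p q : E) {r : ℝ} (hr : dist p q / 2 < r) : segment ℝ p q ⊆ Metric.ball (midpoint ℝ p q) r := by
  refine (convex_ball _ _).segment_subset ?_ ?_
  · rw [Metric.mem_ball, dist_left_midpoint, Real.norm_ofNat]
    linarith
  · rw [Metric.mem_ball, dist_right_midpoint, Real.norm_ofNat]
    linarith

theorem lambdaOne_le_of_isAdmissibleCut {Ω : Set Plane} (hΩ : IsSmoothBoundedDomain Ω)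
    {A : Plane → (Plane →L[ℝ] ℝ)} (hA : IsClosedPotential Ω A) {n : ℕ}
    {Γ : Fin n → Plane × Plane} (hΓ : IsAdmissibleCut Ω Γ)
    (hsum : ∑ j, cutLength Γ j ≤ volume.real Ω / (2 * Real.pi)) (hle : ∀ j, cutLength Γ j ≤ 1) :
    lambdaOne Ω A ≤ 8 * Real.pi * (n : ℝ) / volume.real Ω *
      ∑ j, 1 / |Real.log (cutLength Γ j / 2)| := by
  have hpos : ∀ j, 0 < cutLength Γ j := fun j ↦ dist_pos.2 (hΓ.nondegenerate j)
  have hlog : ∀ j, 0 < -Real.log (cutLength Γ j / 2) := fun j ↦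
    neg_pos.2 (Real.log_neg (by linarith [hpos j]) (by linarith [hle j]))
  have hexp : ∀ j, Real.exp (-(-Real.log (cutLength Γ j / 2))) = cutLength Γ j / 2 := fun j ↦ by
    rw [neg_neg, Real.exp_log (by linarith [hpos j])]
  have hvol : 0 < volume.real Ω := by
    rw [measureReal_def, ENNReal.toReal_pos_iff]
    exact ⟨hΩ.isOpen.measure_pos _ hΩ.isConnected.nonempty, hΩ.isBounded.measure_lt_top⟩
  have hWo : IsOpen (Ω \ ⋃ j, segment ℝ (Γ j).1 (Γ j).2) := by
    refine hΩ.isOpen.sdiff (isClosed_iUnion_of_finite fun j ↦ IsCompact.isClosed ?_)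
    rw [segment_eq_image_lineMap]
    exact isCompact_Icc.image (by fun_prop)
  have hAd : DifferentiableOn ℝ A Ω := (hA.smooth.differentiableOn (by simp)).mono subset_closure
  obtain ⟨φ, hφ⟩ := hΓ.simplyConnected.exists_forall_hasFDerivAt hWo (hAd.mono sdiff_subset)
    fun x hx ↦ hA.closed x hx.1
  -- Take `l j = -ln(h j / 2)`. The half-length `exp(-l j)` is strictly below the inner radius
  -- `exp(-9 l j / 10)`, so each cut lies where its cutoff vanishes.
  have key := lambdaOne_le_of_hasFDerivAt hΩ.isOpen hΩ.isBounded hA.smooth.continuousOn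
    (m := fun j ↦ midpoint ℝ (Γ j).1 (Γ j).2) hlog (φ := φ) (fun x hx hfar ↦ ?_) hvol ?_
  · simpa only [abs_of_neg (neg_pos.1 (hlog _))] using key
  · refine hφ x ⟨hx, fun hmem ↦ ?_⟩
    obtain ⟨j, hj⟩ := mem_iUnion.1 hmem
    refine (hfar j).not_gt (mem_ball_iff_norm.1 (segment_subset_ball_midpoint _ _ ?_ hj))
    change cutLength Γ j / 2 < _
    refine (hexp j).symm.trans_lt (Real.exp_lt_exp.2 ?_)
    linarith [hlog j]
  · simp only [hexp, ← Finset.mul_sum, ← Finset.sum_div]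
    rw [le_div_iff₀ (by positivity)] at hsum
    linarith

/-- The first part holds for every admissible cut whose segments are short enough; the second part
is the case of a cut realizing the minimal total length `h = h(Ω)`. -/
theorem theorem3 (Ω : Set Plane) (hΩ : IsSmoothBoundedDomain Ω)
    (A : Plane → (Plane →L[ℝ] ℝ)) (hA : IsClosedPotential Ω A) :
    (∀ Γ : Fin (numHoles Ω) → Plane × Plane, IsAdmissibleCut Ω Γ →
      ∑ j, cutLength Γ j ≤ volume.real Ω / (2 * Real.pi) →
      (∀ j, cutLength Γ j ≤ 1) →
      lambdaOne Ω A ≤ 8 * Real.pi * (numHoles Ω : ℝ) / volume.real Ω *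
        ∑ j, 1 / |Real.log (cutLength Γ j / 2)|) ∧
    (∀ h : ℝ, IsLeast (cutTotals Ω) h → h ≤ volume.real Ω / (2 * Real.pi) →
      ∀ Γ : Fin (numHoles Ω) → Plane × Plane, IsAdmissibleCut Ω Γ →
      ∑ j, cutLength Γ j = h →
      (∀ j, cutLength Γ j ≤ 1) →
      lambdaOne Ω A ≤ 8 * Real.pi * (numHoles Ω : ℝ) / volume.real Ω *
        ∑ j, 1 / |Real.log (cutLength Γ j / 2)|) :=
  ⟨fun _ hΓ hsum hle ↦ lambdaOne_le_of_isAdmissibleCut hΩ hA hΓ hsum hle,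
    fun _ _ hh _ hΓ hsum hle ↦ lambdaOne_le_of_isAdmissibleCut hΩ hA hΓ (hsum.trans_le hh) hle⟩
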